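/- Let $n,m$ be positive integers, let $q$ be a nonzero complex number, fix a value of $\log q$, and write $q^{\alpha}=e^{\alpha\log q}$ for $\alpha\in\mathbb C$. For a base $Q$ put $(A;Q)_k=\prod_{i=0}^{k-1}(1-AQ^i)$ for integers $k\ge 0$, and, if $|Q|<1$, $(A;Q)_\infty=\prod_{i\ge 0}(1-AQ^i)$. For a complex index $\alpha$ put $$(A;q^s)_\alpha=\frac{(A;q^s)_\infty}{(Aq^{s\alpha};q^s)_\infty}.$$ For $\mathbf k=(k_1,\dots,k_n)$ with non-negative integer entries let $|\mathbf k|=k_1+\dots+k_n$ and $e_2(\mathbf k)=\sum_{r<s}k_rk_s$. Let $h,t\in\mathbb C$ satisfy $0<|q^h|<1$, $0<|q^t|<1$, $0<|q^{ht}|<1$. Let $a_1,\dots,a_n$, $x_1,\dots,x_n$, $y_1,\dots,y_m$, $b,z,w$ be complex numbers with $|w|<1$, with all $x_r,y_r\ne0$ and $|z/x_r|<1$ for $1\le r\le n$, and such that no denominator below vanishes, that is: $q^{hi}x_r/x_s\ne1$ for $r\ne s$ and integers $i\ge0$; $y_r\ne y_s$ for $r\ne s$; and $bwq^{ti}\ne1$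 and $a_rzq^{hi}/x_r\neq1$ for all $r$ and all integers $i\ge0$. (If $(bwq^{t(r-1)};q^t)_{h|\mathbf k|}$ is infinite because $(bwq^{t(r-1)+th|\mathbf k|};q^t)_\infty=0$, its reciprocal is read as $0$.) Then both of the following multiple series converge absolutely, and $$\sum_{k_1,\dots,k_n\ge0}\Bigg(\prod_{1\le r<s\le n}\frac{1-q^{h(k_r-k_s)}x_r/x_s}{1-x_r/x_s}\prod_{r,s=1}^n\frac{(a_sx_r/x_s;q^h)_{k_r}}{(q^hx_r/x_s;q^h)_{k_r}}\prod_{r=1}^m\frac{(wq^{t(r-1)};q^t)_{h|\mathbf k|}}{(bwq^{t(r-1)};q^t)_{h|\mathbf k|}}\; z^{|\mathbf k|}\,q^{h\sum_{r=1}^n(r-1)k_r}\,q^{h\,e_2(\mathbf k)}\prod_{r=1}^n x_r^{-k_r}\Bigg)$$ $$=\prod_{r=1}^m\frac{(wq^{t(r-1)};q^t)_\infty}{(bwq^{t(r-1)};q^t)_\infty}\prod_{r=1}^n\frac{(a_rz/x_r;q^h)_\infty}{(z/x_r;q^h)_\infty}$$ $$\times\sum_{j_1,\dots,j_m\ge0}\Bigg(\prod_{1\le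 r<s\le m}\frac{1-q^{t(j_r-j_s)}y_r/y_s}{1-y_r/y_s}\prod_{r=1}^m\frac{(b;q^t)_{j_r}}{(q^t;q^t)_{j_r}}\prod_{r=1}^n\frac{(z/x_r;q^h)_{t|\mathbf j|}}{(a_rz/x_r;q^h)_{t|\mathbf j|}}\; w^{|\mathbf j|}\,q^{t\sum_{r=1}^m(r-1)j_r}\Bigg).$$ This contains two multiple $q$-binomial theorems as special cases. If $b=1$, the left-hand series is termwise the Milne–Lilly series, and, with $Q=q^h$, $$\sum_{k_1,\dots,k_n\ge0}\prod_{r<s}\frac{1-Q^{k_r-k_s}x_r/x_s}{1-x_r/x_s}\prod_{r,s=1}^n\frac{(a_sx_r/x_s;Q)_{k_r}}{(Qx_r/x_s;Q)_{k_r}}\; z^{|\mathbf k|}Q^{\sum_{r}(r-1)k_r+e_2(\mathbf k)}\prod_{r=1}^n x_r^{-k_r}=\prod_{r=1}^n\frac{(a_rz/x_r;Q)_\infty}{(z/x_r;Q)_\infty}.$$ If $a_1=\dots=a_n=1$, the right-hand series is termwise the Gustafson–Krattenthaler series, and, with $Q=q^t$, $$\sum_{j_1,\dots,j_m\ge0}\prod_{r<s}\frac{1-Q^{j_r-j_s}y_r/y_s}{1-y_r/y_s}\prod_{r=1}^m\frac{(b;Q)_{j_r}}{(Q;Q)_{j_r}}\;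 w^{|\mathbf j|}Q^{\sum_r(r-1)j_r}=\prod_{r=1}^m\frac{(bwQ^{r-1};Q)_\infty}{(wQ^{r-1};Q)_\infty}.$$ Both of these series converge absolutely as well. -/

import Mathlib

open scoped BigOperators

noncomputable section

namespace BibasicHeine

/-- The complex power `q ^ α`, where `lq` is the chosen value of `log q`. -/
def qpow (lq α : ℂ) : ℂ := Complex.exp (α * lq)

/-- The finite `Q`-rising factorial `(A; Q)_k = (1 - A)(1 - A Q) ⋯ (1 - A Q ^ (k - 1))`. -/
def qFac (A Q : ℂ) (k : ℕ) : ℂ := ∏ i ∈ Finset.range k, (1 - A * Q ^ i)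

/-- The infinite `Q`-rising factorial `(A; Q)_∞`, used for `‖Q‖ < 1`. -/
def qInf (A Q : ℂ) : ℂ := ∏' i : ℕ, (1 - A * Q ^ i)

/-- The rising factorial with base `q ^ s` and complex index `α`:
`(A; q ^ s)_α = (A; q ^ s)_∞ / (A q ^ (s α); q ^ s)_∞`. -/
def qFacC (lq A s α : ℂ) : ℂ :=
  qInf A (qpow lq s) / qInf (A * qpow lq (s * α)) (qpow lq s)

/-- The sum of components `|k|`. -/
def size {n : ℕ} (k : Fin n → ℕ) : ℕ := ∑ r, k r

/-- The elementary symmetric function `e₂(k) = ∑_{r < s} k_r k_s`. -/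
def e₂ {n : ℕ} (k : Fin n → ℕ) : ℕ := ∑ r, ∑ s ∈ Finset.Ioi r, k r * k s

/-- The Vandermonde factor of type `A` with base `Q`:
`∏_{r < s} (1 - Q ^ (k_r - k_s) x_r / x_s) / (1 - x_r / x_s)`. -/
def vandermonde (Q : ℂ) {n : ℕ} (x : Fin n → ℂ) (k : Fin n → ℕ) : ℂ :=
  ∏ r, ∏ s ∈ Finset.Ioi r,
    (1 - Q ^ ((k r : ℤ) - (k s : ℤ)) * (x r / x s)) / (1 - x r / x s)

/-- The summand of the Milne–Lilly `A_n` `q`-binomial series with base `Q`.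
The index `r : Fin n` starts at `0`, so it stands for `r - 1` in one-based numbering. -/
def milneLillyTerm (Q : ℂ) {n : ℕ} (a x : Fin n → ℂ) (z : ℂ) (k : Fin n → ℕ) : ℂ :=
  vandermonde Q x k
    * (∏ r, ∏ s, qFac (a s * (x r / x s)) Q (k r) / qFac (Q * (x r / x s)) Q (k r))
    * z ^ size k * Q ^ (∑ r : Fin n, (r : ℕ) * k r) * Q ^ e₂ k * ∏ r, (x r ^ k r)⁻¹

/-- The summand of the Gustafson–Krattenthaler `A_m` `q`-binomial series with base `Q`. -/
def gustafsonKrattenthalerTerm (Q : ℂ) {m : ℕ} (b : ℂ) (y : Fin m → ℂ) (w : ℂ)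
    (j : Fin m → ℕ) : ℂ :=
  vandermonde Q y j * (∏ r, qFac b Q (j r) / qFac Q Q (j r))
    * w ^ size j * Q ^ (∑ r : Fin m, (r : ℕ) * j r)

/-- The summand of the `n`-fold series on the left-hand side of the transformation. -/
def leftTerm (lq h t : ℂ) {n : ℕ} (m : ℕ) (a x : Fin n → ℂ) (b z w : ℂ)
    (k : Fin n → ℕ) : ℂ :=
  vandermonde (qpow lq h) x k
    * (∏ r, ∏ s, qFac (a s * (x r / x s)) (qpow lq h) (k r)
        / qFac (qpow lq h * (x r / x s)) (qpow lq h) (k r))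
    * (∏ r : Fin m, qFacC lq (w * qpow lq (t * (r : ℕ))) t (h * size k)
        / qFacC lq (b * w * qpow lq (t * (r : ℕ))) t (h * size k))
    * z ^ size k * qpow lq (h * (∑ r : Fin n, (r : ℕ) * k r : ℕ)) * qpow lq (h * e₂ k)
    * ∏ r, (x r ^ k r)⁻¹

/-- The summand of the `m`-fold series on the right-hand side of the transformation. -/
def rightTerm (lq h t : ℂ) {n m : ℕ} (a x : Fin n → ℂ) (y : Fin m → ℂ) (b z w : ℂ)
    (j : Fin m → ℕ) : ℂ :=
  vandermonde (qpow lq t) y j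
    * (∏ r, qFac b (qpow lq t) (j r) / qFac (qpow lq t) (qpow lq t) (j r))
    * (∏ r, qFacC lq (z / x r) h (t * size j) / qFacC lq (a r * z / x r) h (t * size j))
    * w ^ size j * qpow lq (t * (∑ r : Fin m, (r : ℕ) * j r : ℕ))

end BibasicHeine

end

open scoped BigOperators
open Finset Filter Topology

namespace BibasicHeine

/-! ### Rising factorials -/

/-! Put `c = q^(ht)` and consider the double series over `(k, j)` of (Milne–Lilly term in `k`) ·
(Gustafson–Krattenthaler term in `j`) · `c^(|k||j|)`. It converges absolutely because both factors
are summable and `|c| < 1`. Since `c^(|k||j|)` replaces `w` by `w c^|k|` or `z` by `z c^|j|`, the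
Gustafson–Krattenthaler theorem evaluates the sum over `j` and the Milne–Lilly theorem the sum over
`k`. Up to the infinite-product prefactors, the results are the two sides, so the transformation is
an interchange of summations, as for Heine's classical formula.

Both multiple theorems reduce to the one-variable `q`-binomial theorem `hasSum_qBinom`. For
Gustafson–Krattenthaler, the Vandermonde factor is a ratio of determinants; expanding the numerator
over permutations splits the series into products of one-variable series.

For Milne–Lilly, the terms with `|k| = N` are summed first. These sums and the coefficients of the
product of `n` one-variable series satisfy the same recurrence in `N`, which shifts one pair `(a_r,
x_r)` to `(Q a_r, Q x_r)`. The recurrences come from two specializations of the partial fraction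
identity `prod_sub_eq_add_sum`: `sum_one_sub_mul_prod` (see `milneLillyLevel_succ`) and
`prod_one_sub_C_mul_X` (see `prod_qBinomSeries_sub_rescale`). -/

@[simp] theorem qFac_zero (A Q : ℂ) : qFac A Q 0 = 1 := by simp [qFac]

theorem qFac_succ (A Q : ℂ) (k : ℕ) : qFac A Q (k + 1) = qFac A Q k * (1 - A * Q ^ k) :=
  prod_range_succ _ _

theorem qFac_succ' (A Q : ℂ) (k : ℕ) : qFac A Q (k + 1) = (1 - A) * qFac (Q * A) Q k := by
  rw [qFac, prod_range_succ', mul_comm, pow_zero, mul_one]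
  congr 1
  exact prod_congr rfl fun i _ => by ring

theorem qFac_ne_zero {A Q : ℂ} (hA : ∀ i : ℕ, A * Q ^ i ≠ 1) (k : ℕ) : qFac A Q k ≠ 0 :=
  prod_ne_zero_iff.2 fun i _ => sub_ne_zero.2 (hA i).symm

theorem summable_norm_mul_pow (A : ℂ) {Q : ℂ} (hQ : ‖Q‖ < 1) :
    Summable fun i : ℕ => ‖-(A * Q ^ i)‖ := by
  simp only [norm_neg, norm_mul, norm_pow]
  exact (summable_geometric_of_lt_one (norm_nonneg _) hQ).mul_left _

theorem multipliable_qInf (A : ℂ) {Q : ℂ} (hQ : ‖Q‖ < 1) :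
    Multipliable fun i : ℕ => 1 - A * Q ^ i := by
  simpa [sub_eq_add_neg] using multipliable_one_add_of_summable (summable_norm_mul_pow A hQ)

theorem qInf_ne_zero {A Q : ℂ} (hQ : ‖Q‖ < 1) (hA : ∀ i : ℕ, A * Q ^ i ≠ 1) : qInf A Q ≠ 0 := by
  have := tprod_one_add_ne_zero_of_summable (f := fun i : ℕ => -(A * Q ^ i))
    (fun i => by simpa [← sub_eq_add_neg] using sub_ne_zero.2 (hA i).symm)
    (summable_norm_mul_pow A hQ)
  simpa [qInf, sub_eq_add_neg] using this

theorem mul_pow_ne_one {A Q : ℂ} (hA : ‖A‖ < 1) (hQ : ‖Q‖ < 1) (i : ℕ) : A * Q ^ i ≠ 1 := by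
  intro h
  have h1 : ‖A * Q ^ i‖ = 1 := by rw [h, norm_one]
  rw [norm_mul, norm_pow] at h1
  have := pow_le_one₀ (n := i) (norm_nonneg _) hQ.le
  nlinarith [norm_nonneg A, pow_nonneg (norm_nonneg Q) i]

theorem tendsto_qFac (A : ℂ) {Q : ℂ} (hQ : ‖Q‖ < 1) :
    Tendsto (qFac A Q) atTop (𝓝 (qInf A Q)) :=
  (multipliable_qInf A hQ).hasProd.tendsto_prod_nat

theorem exists_norm_qFac_le (A : ℂ) {Q : ℂ} (hQ : ‖Q‖ < 1) :
    ∃ C : ℝ, 0 ≤ C ∧ ∀ k, ‖qFac A Q k‖ ≤ C := by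
  obtain ⟨C, hC⟩ := (tendsto_qFac A hQ).norm.bddAbove_range
  have h : ∀ k, ‖qFac A Q k‖ ≤ C := fun k => hC ⟨k, rfl⟩
  exact ⟨C, (norm_nonneg _).trans (h 0), h⟩

theorem exists_norm_inv_qFac_le {A Q : ℂ} (hQ : ‖Q‖ < 1) (hA : ∀ i : ℕ, A * Q ^ i ≠ 1) :
    ∃ C : ℝ, 0 ≤ C ∧ ∀ k, ‖(qFac A Q k)⁻¹‖ ≤ C := by
  obtain ⟨C, hC⟩ := ((tendsto_qFac A hQ).inv₀ (qInf_ne_zero hQ hA)).norm.bddAbove_range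
  have h : ∀ k, ‖(qFac A Q k)⁻¹‖ ≤ C := fun k => hC ⟨k, rfl⟩
  exact ⟨C, (norm_nonneg _).trans (h 0), h⟩

theorem exists_norm_qFac_div_le (A : ℂ) {B Q : ℂ} (hQ : ‖Q‖ < 1) (hB : ∀ i : ℕ, B * Q ^ i ≠ 1) :
    ∃ C : ℝ, 0 ≤ C ∧ ∀ k, ‖qFac A Q k / qFac B Q k‖ ≤ C := by
  obtain ⟨C, hC0, hC⟩ := exists_norm_qFac_le A hQ
  obtain ⟨D, hD0, hD⟩ := exists_norm_inv_qFac_le hQ hB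
  refine ⟨C * D, mul_nonneg hC0 hD0, fun k => ?_⟩
  rw [div_eq_mul_inv, norm_mul]
  exact mul_le_mul (hC k) (hD k) (norm_nonneg _) hC0

/-! ### The `q`-binomial theorem in one variable -/

/-- The coefficient `(b; Q)_k / (Q; Q)_k` of the `q`-binomial series. -/
noncomputable def qBinomCoeff (b Q : ℂ) (k : ℕ) : ℂ := qFac b Q k / qFac Q Q k

@[simp] theorem qBinomCoeff_zero (b Q : ℂ) : qBinomCoeff b Q 0 = 1 := by simp [qBinomCoeff]

theorem qBinomCoeff_succ_mul {Q : ℂ} (hQ : ‖Q‖ < 1) (b : ℂ) (k : ℕ) :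
    qBinomCoeff b Q (k + 1) * (1 - Q ^ (k + 1)) = qBinomCoeff b Q k * (1 - b * Q ^ k) := by
  have h1 := qFac_ne_zero (mul_pow_ne_one hQ hQ) k
  have h2 : 1 - Q * Q ^ k ≠ 0 := sub_ne_zero.2 (mul_pow_ne_one hQ hQ k).symm
  rw [qBinomCoeff, qBinomCoeff, qFac_succ, qFac_succ, pow_succ', div_mul_eq_mul_div, div_mul_eq_mul_div,
    div_eq_div_iff (mul_ne_zero h1 h2) h1]
  ring

theorem qBinomCoeff_succ_mul' {Q : ℂ} (hQ : ‖Q‖ < 1) (b : ℂ) (k : ℕ) :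
    qBinomCoeff b Q (k + 1) * (1 - Q ^ (k + 1)) = (1 - b) * qBinomCoeff (Q * b) Q k := by
  have h1 := qFac_ne_zero (mul_pow_ne_one hQ hQ) k
  have h2 : 1 - Q * Q ^ k ≠ 0 := sub_ne_zero.2 (mul_pow_ne_one hQ hQ k).symm
  rw [qBinomCoeff, qBinomCoeff, qFac_succ', qFac_succ Q, pow_succ']
  field_simp

theorem summable_norm_qBinom {Q z : ℂ} (hQ : ‖Q‖ < 1) (hz : ‖z‖ < 1) (b : ℂ) :
    Summable fun k => ‖qBinomCoeff b Q k * z ^ k‖ := by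
  obtain ⟨C, -, hC⟩ := exists_norm_qFac_div_le b hQ (mul_pow_ne_one hQ hQ)
  refine Summable.of_nonneg_of_le (fun _ => norm_nonneg _) (fun k => ?_)
    ((summable_geometric_of_lt_one (norm_nonneg _) hz).mul_left C)
  rw [norm_mul, norm_pow]
  exact mul_le_mul_of_nonneg_right (hC k) (by positivity)

/-- Multiplying the coefficient recurrence by `z^(k+1)` and summing gives `f(z) - f(Qz) = z (f(z) -
b f(Qz))`; the constant terms on the left cancel. -/
theorem qBinom_functional {Q z : ℂ} (hQ : ‖Q‖ < 1) (hz : ‖z‖ < 1) (b : ℂ) :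
    (1 - z) * ∑' k, qBinomCoeff b Q k * z ^ k
      = (1 - b * z) * ∑' k, qBinomCoeff b Q k * (Q * z) ^ k := by
  have hQz : ‖Q * z‖ < 1 := by
    rw [norm_mul]; exact mul_lt_one_of_nonneg_of_lt_one_left (norm_nonneg _) hQ hz.le
  have s1 := (summable_norm_qBinom hQ hz b).of_norm
  have s2 := (summable_norm_qBinom hQ hQz b).of_norm
  have e : ∑' k, qBinomCoeff b Q k * z ^ k - ∑' k, qBinomCoeff b Q k * (Q * z) ^ k
      = z * (∑' k, qBinomCoeff b Q k * z ^ k - b * ∑' k, qBinomCoeff b Q k * (Q * z) ^ k) := by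
    rw [← s1.tsum_sub s2, (s1.sub s2).tsum_eq_zero_add, ← tsum_mul_left,
      ← s1.tsum_sub (s2.mul_left b), ← tsum_mul_left]
    simp only [pow_zero, sub_self, zero_add]
    refine tsum_congr fun k => ?_
    linear_combination z ^ (k + 1) * qBinomCoeff_succ_mul hQ b k
  linear_combination e

theorem norm_mul_pow_lt_one {z Q : ℂ} (hz : ‖z‖ < 1) (hQ : ‖Q‖ < 1) (N : ℕ) :
    ‖z * Q ^ N‖ < 1 := by
  rw [norm_mul, norm_pow]
  exact mul_lt_one_of_nonneg_of_lt_one_left (norm_nonneg _) hz (pow_le_one₀ (norm_nonneg _) hQ.le)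

theorem qBinom_iterate {Q z : ℂ} (hQ : ‖Q‖ < 1) (hz : ‖z‖ < 1) (b : ℂ) (N : ℕ) :
    qFac z Q N * ∑' k, qBinomCoeff b Q k * z ^ k
      = qFac (b * z) Q N * ∑' k, qBinomCoeff b Q k * (z * Q ^ N) ^ k := by
  induction N with
  | zero => simp
  | succ N ih =>
    have := qBinom_functional hQ (norm_mul_pow_lt_one hz hQ N) b
    rw [show Q * (z * Q ^ N) = z * Q ^ (N + 1) by ring] at this
    rw [qFac_succ, qFac_succ]
    linear_combination (1 - z * Q ^ N) * ih + qFac (b * z) Q N * this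

/-- Iterating the functional equation moves the argument to `z Q^N`. As `N → ∞` the series there
tends to its constant term `1` by dominated convergence, and the finite products tend to the
infinite ones. -/
theorem hasSum_qBinom {Q z : ℂ} (hQ : ‖Q‖ < 1) (hz : ‖z‖ < 1) (b : ℂ) :
    HasSum (fun k => qBinomCoeff b Q k * z ^ k) (qInf (b * z) Q / qInf z Q) := by
  have hs := summable_norm_qBinom hQ hz b
  have hlim : Tendsto (fun N : ℕ => ∑' k, qBinomCoeff b Q k * (z * Q ^ N) ^ k) atTop (𝓝 1) := by
    have : (1 : ℂ) = ∑' k : ℕ, if k = 0 then 1 else 0 := by simp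
    rw [this]
    refine tendsto_tsum_of_dominated_convergence hs (fun k => ?_)
      (Eventually.of_forall fun N k => ?_)
    · rcases k with _ | k
      · simp
      · have h0 : Tendsto (fun N : ℕ => z * Q ^ N) atTop (𝓝 0) := by
          simpa using (tendsto_pow_atTop_nhds_zero_of_norm_lt_one hQ).const_mul z
        simpa using (h0.pow (k + 1)).const_mul (qBinomCoeff b Q (k + 1))
    · rw [norm_mul, norm_mul, norm_pow, norm_pow, norm_mul, norm_pow]
      have := pow_le_one₀ (n := N) (norm_nonneg _) hQ.le
      gcongr
      exact mul_le_of_le_one_right (norm_nonneg _) this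
  have h1 := (tendsto_qFac z hQ).mul_const (∑' k, qBinomCoeff b Q k * z ^ k)
  have h2 := (tendsto_qFac (b * z) hQ).mul hlim
  simp only [qBinom_iterate hQ hz b] at h1
  have h3 := tendsto_nhds_unique h1 h2
  rw [← show ∑' k, qBinomCoeff b Q k * z ^ k = _ from
    eq_div_of_mul_eq (qInf_ne_zero hQ (mul_pow_ne_one hz hQ)) (by linear_combination h3)]
  exact hs.of_norm.hasSum

/-! ### Products of series -/

theorem hasSum_prod_pi {n : ℕ} {f : Fin n → ℕ → ℂ} (hf : ∀ r, Summable fun k => ‖f r k‖) :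
    HasSum (fun k : Fin n → ℕ => ∏ r, f r (k r)) (∏ r, ∑' k, f r k) := by
  induction n with
  | zero => simp [hasSum_unique]
  | succ n ih =>
    have h := ih (f := fun r => f r.succ) fun r => hf r.succ
    have h0 := (hf 0).of_norm.hasSum
    have hs : Summable fun p : ℕ × (Fin n → ℕ) => f 0 p.1 * ∏ r : Fin n, f r.succ (p.2 r) :=
      summable_mul_of_summable_norm (f := f 0)
        (g := fun k : Fin n → ℕ => ∏ r : Fin n, f r.succ (k r)) (hf 0) h.summable.norm
    have := h0.mul h hs
    rw [Fin.prod_univ_succ]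
    refine (Equiv.hasSum_iff (Fin.consEquiv fun _ : Fin (n + 1) => ℕ)).1 (this.congr_fun ?_)
    rintro ⟨i, k⟩
    simp [Fin.prod_univ_succ, Fin.consEquiv]

/-- The sets `|k| = N` are finite and partition the indices, so a sum may be regrouped along them.
-/
theorem hasSum_unique_of_piAntidiag {n : ℕ} {f g : (Fin n → ℕ) → ℂ} {u v : ℂ}
    (hf : HasSum f u) (hg : HasSum g v)
    (h : ∀ N, ∑ k ∈ piAntidiag univ N, f k = ∑ k ∈ piAntidiag univ N, g k) : u = v := by
  have key : ∀ {f : (Fin n → ℕ) → ℂ} {u : ℂ}, HasSum f u →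
      HasSum (fun N => ∑ k ∈ piAntidiag univ N, f k) u := by
    intro f u hf
    refine (hf.tsum_fiberwise (fun k => ∑ r, k r)).congr_fun fun N => ?_
    have : (fun k : Fin n → ℕ => ∑ r, k r) ⁻¹' ({N} : Set ℕ) = ↑(piAntidiag (univ : Finset (Fin n)) N) := by
      ext k; simp
    rw [this, Finset.tsum_subtype']
  have h1 := key hf
  simp only [h] at h1
  exact h1.unique (key hg)

/-! ### Partial fractions -/

open Polynomial in
-- The difference of two monic polynomials of equal degree has smaller degree, so it equals its
-- Lagrange interpolant at the nodes `ξ`, where one of the two products vanishes.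
theorem prod_sub_eq_add_sum {ι : Type*} [Fintype ι] [DecidableEq ι] {ξ : ι → ℂ}
    (hξ : Function.Injective ξ) (α : ι → ℂ) (y : ℂ) :
    ∏ r, (y - α r) = ∏ r, (y - ξ r)
      + ∑ r, (∏ s, (ξ r - α s)) * ∏ s ∈ univ.erase r, (y - ξ s) / (ξ r - ξ s) := by
  rcases isEmpty_or_nonempty ι with hι | hι
  · simp
  have hm : ∀ β : ι → ℂ, (∏ r, (X - C (β r))).Monic := fun β =>
    monic_prod_of_monic _ _ fun r _ => monic_X_sub_C _
  have hd : ∀ β : ι → ℂ, (∏ r, (X - C (β r))).degree = ((Fintype.card ι : ℕ) : WithBot ℕ) := fun β => by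
    simp [degree_prod]
  have hlt : ((∏ r, (X - C (α r))) - ∏ r, (X - C (ξ r))).degree < ((univ : Finset ι).card : WithBot ℕ) := by
    rw [card_univ, ← hd α]
    exact degree_sub_lt_left ((hd α).trans (hd ξ).symm) (hm α).ne_zero
      ((hm α).trans (hm ξ).symm)
  have h := congrArg (eval y) (Lagrange.eq_interpolate hξ.injOn hlt)
  rw [Lagrange.interpolate_apply] at h
  simp only [eval_sub, eval_prod, eval_X, eval_C, eval_finsetSum, eval_mul, Lagrange.basis,
    Lagrange.basisDivisor] at h
  rw [eq_add_of_sub_eq' h]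
  congr 1
  refine sum_congr rfl fun r _ => ?_
  rw [prod_eq_zero (f := fun s => ξ r - ξ s) (mem_univ r) (sub_self _), sub_zero]
  simp only [div_eq_inv_mul]

/-- This is the partial fraction identity at `y = 0`, divided by `∏ (-x r)`. With `c r = Q ^ k r` it
splits `1 - Q^|k|` into terms whose `r`-th vanishes when `k r = 0`. -/
theorem sum_one_sub_mul_prod {ι : Type*} [Fintype ι] [DecidableEq ι] {x : ι → ℂ}
    (hx : ∀ r, x r ≠ 0) (hinj : Function.Injective x) (c : ι → ℂ) :
    ∑ r, (1 - c r) * ∏ s ∈ univ.erase r, (x r - x s * c s) / (x r - x s) = 1 - ∏ r, c r := by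
  have h := prod_sub_eq_add_sum hinj (fun r => x r * c r) 0
  have hP : ∏ r, -x r ≠ 0 := prod_ne_zero_iff.2 fun r _ => neg_ne_zero.2 (hx r)
  have e : ∀ r, (∏ s, (x r - x s * c s)) * ∏ s ∈ univ.erase r, (0 - x s) / (x r - x s)
      = -((∏ r, -x r) *
        ((1 - c r) * ∏ s ∈ univ.erase r, (x r - x s * c s) / (x r - x s))) := fun r => by
    rw [← mul_prod_erase univ (fun s => x r - x s * c s) (mem_univ r),
      ← mul_prod_erase univ (fun s => -x s) (mem_univ r)]
    simp only [prod_div_distrib, zero_sub]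
    ring
  rw [sum_congr rfl fun r _ => e r, sum_neg_distrib, ← mul_sum] at h
  simp only [zero_sub] at h
  have h2 : ∏ r, -(x r * c r) = (∏ r, -x r) * ∏ r, c r := by
    rw [← prod_mul_distrib]; exact prod_congr rfl fun r _ => by ring
  rw [h2] at h
  apply mul_left_cancel₀ hP
  linear_combination h

/-- The weight of the shift of the `r`-th variable in the recurrence for the Milne–Lilly
coefficients. -/
noncomputable def shiftWeight {n : ℕ} (a x : Fin n → ℂ) (r : Fin n) : ℂ :=
  (x r)⁻¹ * (1 - a r) * ∏ s ∈ univ.erase r, (1 - a s * (x r / x s)) / (1 - x r / x s)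

open Polynomial in
-- For `z ≠ 0` this is the partial fraction identity with nodes `1 / x r` at `y = 1 / z`, multiplied
-- by `z ^ n`. Agreement at infinitely many points gives the polynomial identity.
theorem prod_one_sub_C_mul_X {n : ℕ} (a : Fin n → ℂ) {x : Fin n → ℂ} (hx : ∀ r, x r ≠ 0)
    (hinj : Function.Injective x) :
    ∏ r, (1 - C (a r * (x r)⁻¹) * X) = ∏ r, (1 - C (x r)⁻¹ * X)
      + X * ∑ r, C (shiftWeight a x r) * ∏ s ∈ univ.erase r, (1 - C (x s)⁻¹ * X) := by
  refine Polynomial.eq_of_infinite_eval_eq _ _ (Set.Infinite.mono ?_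
    (Set.finite_singleton (0 : ℂ)).infinite_compl)
  intro z hz
  have hz : z ≠ 0 := hz
  have h := prod_sub_eq_add_sum (inv_injective.comp hinj) (fun r => a r * (x r)⁻¹) z⁻¹
  have hp : ∀ (S : Finset (Fin n)) (β : Fin n → ℂ),
      ∏ r ∈ S, (1 - β r * z) = (∏ r ∈ S, z) * ∏ r ∈ S, (z⁻¹ - β r) := fun S β => by
    rw [← prod_mul_distrib]; exact prod_congr rfl fun r _ => by field_simp
  simp only [Set.mem_ofPred_eq, eval_add, eval_mul, eval_prod, eval_sub, eval_one, eval_C, eval_X,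
    eval_finsetSum, hp]
  rw [h, mul_add, mul_sum, mul_sum]
  congr 1
  refine sum_congr rfl fun r _ => ?_
  have hr := hx r
  have e : ∏ s ∈ univ.erase r, (1 - a s * (x r / x s)) / (1 - x r / x s)
      = ∏ s ∈ univ.erase r, ((x r)⁻¹ - a s * (x s)⁻¹) / ((x r)⁻¹ - (x s)⁻¹) :=
    prod_congr rfl fun s _ => by
      rw [← mul_div_mul_left _ _ (inv_ne_zero hr)]
      congr 1 <;> field_simp
  rw [shiftWeight, e, ← mul_prod_erase univ _ (mem_univ r),
    ← mul_prod_erase univ (fun s => (_ - a s * (x s)⁻¹)) (mem_univ r)]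
  simp only [prod_div_distrib, Function.comp_apply]
  ring

/-! ### Products over pairs of indices -/

/-- Separates the pairs that contain `r`; symmetry of `f` lets all of them be written with `r`
first. -/
theorem prod_Ioi_eq_mul_prod_erase {n : ℕ} (r : Fin n) {f : Fin n → Fin n → ℂ}
    (hf : ∀ p s, f p s = f s p) :
    ∏ p, ∏ s ∈ Ioi p, f p s
      = (∏ s ∈ univ.erase r, f r s) * ∏ p ∈ univ.erase r, ∏ s ∈ (Ioi p).erase r, f p s := by
  have h1 : ∀ p ∈ univ.erase r, ∏ s ∈ Ioi p, f p s
      = (if p < r then f r p else 1) * ∏ s ∈ (Ioi p).erase r, f p s := fun p _ => by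
    split_ifs with h
    · rw [hf r p, mul_prod_erase _ _ (mem_Ioi.2 h)]
    · rw [erase_eq_of_notMem (by simpa using h), one_mul]
  have h2 : ∏ s ∈ Ioi r, f r s = ∏ s ∈ univ.erase r, if r < s then f r s else 1 := by
    rw [← prod_filter]
    refine prod_congr ?_ fun _ _ => rfl
    ext s
    simp only [mem_Ioi, mem_filter, mem_erase, mem_univ, and_true]
    exact ⟨fun h => ⟨h.ne', h⟩, fun h => h.2⟩
  rw [← mul_prod_erase univ _ (mem_univ r), prod_congr rfl h1, prod_mul_distrib, ← mul_assoc, h2,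
    ← prod_mul_distrib]
  congr 1
  refine prod_congr rfl fun s hs => ?_
  rcases lt_or_gt_of_ne (ne_of_mem_erase hs) with h | h <;> simp [h, h.not_gt]

theorem prod_prod_eq_mul_prod_Ioi {n : ℕ} (f : Fin n → Fin n → ℂ) :
    ∏ p, ∏ s, f p s = (∏ p, f p p) * ∏ p, ∏ s ∈ Ioi p, f p s * f s p := by
  have h := prod_prod_Ioi_mul_eq_prod_prod_off_diag fun i j => f j i
  rw [h, ← prod_mul_distrib]
  refine prod_congr rfl fun p _ => ?_
  rw [← mul_prod_erase univ _ (mem_univ p)]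
  congr 1
  refine prod_congr ?_ fun _ _ => rfl
  ext s; simp

theorem sum_val_mul_eq_sum_Ioi {n : ℕ} (k : Fin n → ℕ) :
    ∑ r : Fin n, (r : ℕ) * k r = ∑ p, ∑ s ∈ Ioi p, k s := by
  rw [sum_comm' (t' := univ) (s' := fun s => Iio s) (by simp)]
  simp

/-- The power of `Q` supplies one factor `Q ^ k s` for each pair `p < s`, which clears the negative
exponent in that pair. The result is a ratio of Vandermonde determinants. -/
theorem vandermonde_mul_pow {Q : ℂ} (hQ : Q ≠ 0) {n : ℕ} {x : Fin n → ℂ} (hx : ∀ r, x r ≠ 0)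
    (k : Fin n → ℕ) :
    vandermonde Q x k * Q ^ (∑ r : Fin n, (r : ℕ) * k r)
      = ∏ p, ∏ s ∈ Ioi p, (x s * Q ^ k s - x p * Q ^ k p) / (x s - x p) := by
  rw [sum_val_mul_eq_sum_Ioi, vandermonde]
  simp only [← prod_pow_eq_pow_sum, ← prod_mul_distrib]
  refine prod_congr rfl fun p _ => prod_congr rfl fun s _ => ?_
  have hs := hx s
  have hk : Q ^ k s ≠ 0 := pow_ne_zero _ hQ
  rw [zpow_sub₀ hQ, zpow_natCast, zpow_natCast, div_mul_eq_mul_div,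
    ← mul_div_mul_left _ (1 - x p / x s) hs]
  congr 1 <;> field_simp

/-! ### The coefficients of the Milne–Lilly series -/

/-- The factor of a Milne–Lilly coefficient that belongs to a pair of indices. -/
noncomputable def pairFactor (Q : ℂ) {n : ℕ} (a x : Fin n → ℂ) (k : Fin n → ℕ) (p s : Fin n) : ℂ :=
  (x s * Q ^ k s - x p * Q ^ k p) / (x s - x p) * Q ^ (k p * k s)
    * (qFac (a s * (x p / x s)) Q (k p) / qFac (Q * (x p / x s)) Q (k p)
      * (qFac (a p * (x s / x p)) Q (k s) / qFac (Q * (x s / x p)) Q (k s)))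

theorem pairFactor_comm (Q : ℂ) {n : ℕ} (a x : Fin n → ℂ) (k : Fin n → ℕ) (p s : Fin n) :
    pairFactor Q a x k p s = pairFactor Q a x k s p := by
  rw [pairFactor, pairFactor, ← neg_sub (x p), ← neg_sub (x p * _), neg_div_neg_eq,
    mul_comm (k p)]
  ring

/-- The Milne–Lilly coefficient as a product over indices and pairs of indices. -/
noncomputable def milneLillyCoeff (Q : ℂ) {n : ℕ} (a x : Fin n → ℂ) (k : Fin n → ℕ) : ℂ :=
  (∏ p, qBinomCoeff (a p) Q (k p) * (x p ^ k p)⁻¹) * ∏ p, ∏ s ∈ Ioi p, pairFactor Q a x k p s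

theorem milneLillyTerm_eq {Q : ℂ} (hQ : Q ≠ 0) {n : ℕ} (a : Fin n → ℂ) {x : Fin n → ℂ}
    (hx : ∀ r, x r ≠ 0) (z : ℂ) (k : Fin n → ℕ) :
    milneLillyTerm Q a x z k = milneLillyCoeff Q a x k * z ^ size k := by
  rw [milneLillyTerm, milneLillyCoeff, prod_prod_eq_mul_prod_Ioi]
  simp only [pairFactor, prod_mul_distrib, div_self (hx _), mul_one, e₂, ← prod_pow_eq_pow_sum,
    qBinomCoeff]
  have h := vandermonde_mul_pow hQ hx k
  simp only [← prod_pow_eq_pow_sum] at h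
  rw [← h]
  ring

/-- Shifting `(a r, x r)` to `(Q a r, Q x r)` while lowering `k r` from `l r + 1` to `l r` preserves
`x r * Q ^ k r` and `a r / x r`. Only boundary factors of the rising factorials and a power `Q ^ l
s` change. -/
theorem pairFactor_shift {Q : ℂ} (hQ0 : Q ≠ 0) {n : ℕ} {a x : Fin n → ℂ}
    (hx : ∀ r, x r ≠ 0) (hxx : ∀ r s, r ≠ s → ∀ i : ℕ, Q ^ i * (x r / x s) ≠ 1)
    (l : Fin n → ℕ) {r s : Fin n} (hrs : s ≠ r) :
    (1 - a s * (x r / x s)) / (1 - x r / x s) * Q ^ l s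
        * pairFactor Q (Function.update a r (Q * a r)) (Function.update x r (Q * x r)) l r s
      = pairFactor Q a x (Function.update l r (l r + 1)) r s
        * ((x r - x s * Q ^ l s) / (x r - x s)) := by
  have hF1 : qFac (Q * (Q * (x r / x s))) Q (l r) ≠ 0 := qFac_ne_zero (fun i => by
    convert hxx r s hrs.symm (i + 2) using 1; ring) _
  have hF2 : qFac (Q * (x s / x r)) Q (l s) ≠ 0 := qFac_ne_zero (fun i => by
    convert hxx s r hrs (i + 1) using 1; ring) _
  have hF3 : qFac (x s / x r) Q (l s) ≠ 0 := qFac_ne_zero (fun i => by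
    convert hxx s r hrs i using 1; ring) _
  have hF4 : (1 - x s / x r) * qFac (Q * (x s / x r)) Q (l s)
      = qFac (x s / x r) Q (l s) * (1 - x s / x r * Q ^ l s) := by
    rw [← qFac_succ', qFac_succ]
  have hr := hx r
  have hs := hx s
  have h0 : x r - x s ≠ 0 := fun h => hxx r s hrs.symm 0 (by
    rw [pow_zero, one_mul, sub_eq_zero.1 h, div_self hs])
  have h1 : x s - Q * x r ≠ 0 := fun h => hxx r s hrs.symm 1 (by
    rw [pow_one, mul_div_assoc', ← sub_eq_zero.1 h, div_self hs])
  simp only [pairFactor, Function.update_self, Function.update_of_ne hrs]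
  rw [show a s * (Q * x r / x s) = Q * (a s * (x r / x s)) by ring,
    show Q * (Q * x r / x s) = Q * (Q * (x r / x s)) by ring,
    show Q * a r * (x s / (Q * x r)) = a r * (x s / x r) by field_simp,
    show Q * (x s / (Q * x r)) = x s / x r by field_simp, qFac_succ' _ _ (l r),
    qFac_succ' _ _ (l r)]
  generalize qFac (Q * (a s * (x r / x s))) Q (l r) = F5 at *
  generalize qFac (a r * (x s / x r)) Q (l s) = F6 at *
  generalize qFac (Q * (Q * (x r / x s))) Q (l r) = F1 at *
  -- These two rising factorials differ only in their end factors; this is the source of the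
  -- quotient `(x r - x s * Q ^ l s) / (x r - x s)`.
  have h2 : qFac (Q * (x s / x r)) Q (l s)
      = qFac (x s / x r) Q (l s) * (x r - x s * Q ^ l s) / (x r - x s) := by
    rw [eq_div_iff h0]
    have e : x r * (x s / x r) = x s := by field_simp
    linear_combination x r * hF4 + (qFac (Q * (x s / x r)) Q (l s)
      - qFac (x s / x r) Q (l s) * Q ^ l s) * e
  rw [h2] at hF2 ⊢
  have h3 : x r - x s * Q ^ l s ≠ 0 := fun h => hF2 (by rw [h, mul_zero, zero_div])
  generalize qFac (x s / x r) Q (l s) = F3 at *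
  have h4 : x s - x r ≠ 0 := fun h => h0 (by linear_combination -h)
  rw [show 1 - x r / x s = (x s - x r) / x s by field_simp,
    show 1 - Q * (x r / x s) = (x s - Q * x r) / x s by field_simp]
  generalize 1 - a s * (x r / x s) = B at *
  field_simp
  ring

/-- Factors not involving `r` are unaffected. The single-index factor of `r` changes by
`qBinomCoeff_succ_mul'`, the pairs containing `r` by `pairFactor_shift`, and `Q^|l|` is distributed
among them. -/
theorem milneLillyCoeff_shift {Q : ℂ} (hQ0 : Q ≠ 0) (hQ : ‖Q‖ < 1) {n : ℕ} {a x : Fin n → ℂ}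
    (hx : ∀ r, x r ≠ 0) (hxx : ∀ r s, r ≠ s → ∀ i : ℕ, Q ^ i * (x r / x s) ≠ 1)
    (l : Fin n → ℕ) (r : Fin n) :
    Q ^ (∑ s, l s) * shiftWeight a x r
        * milneLillyCoeff Q (Function.update a r (Q * a r)) (Function.update x r (Q * x r)) l
      = milneLillyCoeff Q a x (Function.update l r (l r + 1))
        * ((1 - Q ^ (l r + 1)) * ∏ s ∈ univ.erase r, (x r - x s * Q ^ l s) / (x r - x s)) := by
  have hr := hx r
  have hd : Q ^ l r * (x r)⁻¹ * (1 - a r) * (qBinomCoeff (Q * a r) Q (l r) * ((Q * x r) ^ l r)⁻¹)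
      = qBinomCoeff (a r) Q (l r + 1) * (x r ^ (l r + 1))⁻¹ * (1 - Q ^ (l r + 1)) := by
    have h := qBinomCoeff_succ_mul' hQ (a r) (l r)
    calc _ = ((1 - a r) * qBinomCoeff (Q * a r) Q (l r)) * (x r ^ (l r + 1))⁻¹ := by
          have := pow_ne_zero (l r) hQ0
          rw [mul_pow, mul_inv]
          field_simp
          ring
      _ = _ := by rw [← h]; ring
  have hp : (∏ s ∈ univ.erase r, (1 - a s * (x r / x s)) / (1 - x r / x s) * Q ^ l s)
      * ∏ s ∈ univ.erase r,
        pairFactor Q (Function.update a r (Q * a r)) (Function.update x r (Q * x r)) l r s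
      = (∏ s ∈ univ.erase r, pairFactor Q a x (Function.update l r (l r + 1)) r s)
        * ∏ s ∈ univ.erase r, (x r - x s * Q ^ l s) / (x r - x s) := by
    rw [← prod_mul_distrib, ← prod_mul_distrib]
    exact prod_congr rfl fun s hs => pairFactor_shift hQ0 hx hxx l (ne_of_mem_erase hs)
  have h1 : ∏ p ∈ univ.erase r, (qBinomCoeff (Function.update a r (Q * a r) p) Q (l p)
        * (Function.update x r (Q * x r) p ^ l p)⁻¹)
      = ∏ p ∈ univ.erase r, (qBinomCoeff (a p) Q (Function.update l r (l r + 1) p)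
        * (x p ^ Function.update l r (l r + 1) p)⁻¹) :=
    prod_congr rfl fun p hp => by simp only [Function.update_of_ne (ne_of_mem_erase hp)]
  have h2 : ∏ p ∈ univ.erase r, ∏ s ∈ (Ioi p).erase r,
        pairFactor Q (Function.update a r (Q * a r)) (Function.update x r (Q * x r)) l p s
      = ∏ p ∈ univ.erase r, ∏ s ∈ (Ioi p).erase r,
        pairFactor Q a x (Function.update l r (l r + 1)) p s :=
    prod_congr rfl fun p hp => prod_congr rfl fun s hs => by
      simp only [pairFactor, Function.update_of_ne (ne_of_mem_erase hp),
        Function.update_of_ne (ne_of_mem_erase hs)]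
  rw [milneLillyCoeff, milneLillyCoeff, prod_Ioi_eq_mul_prod_erase r (pairFactor_comm Q _ _ _),
    prod_Ioi_eq_mul_prod_erase r (pairFactor_comm Q a x _), h2,
    ← mul_prod_erase univ _ (mem_univ r), h1, shiftWeight,
    ← mul_prod_erase univ (fun p => qBinomCoeff (a p) Q (Function.update l r (l r + 1) p)
        * (x p ^ Function.update l r (l r + 1) p)⁻¹) (mem_univ r),
    ← add_sum_erase univ l (mem_univ r), pow_add, ← prod_pow_eq_pow_sum]
  rw [prod_mul_distrib] at hp
  simp only [Function.update_self]
  generalize (∏ p ∈ univ.erase r, ∏ s ∈ (Ioi p).erase r,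
        pairFactor Q a x (Function.update l r (l r + 1)) p s) = G at *
  generalize (∏ p ∈ univ.erase r, (qBinomCoeff (a p) Q (Function.update l r (l r + 1) p)
        * (x p ^ Function.update l r (l r + 1) p)⁻¹)) = H at *
  linear_combination (congrArg₂ (· * ·) hd hp) * (G * H)

/-- The sum of the Milne–Lilly coefficients over all indices of size `N`. -/
noncomputable def milneLillyLevel (Q : ℂ) {n : ℕ} (a x : Fin n → ℂ) (N : ℕ) : ℂ :=
  ∑ k ∈ piAntidiag univ N, milneLillyCoeff Q a x k

/-- Expand `1 - Q^|k|` by `sum_one_sub_mul_prod` and exchange the sums. In the `r`-th part only `k r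
> 0` contributes, so `k` is obtained from some `l` of size `N` by raising `l r` by one. -/
theorem milneLillyLevel_succ {Q : ℂ} (hQ0 : Q ≠ 0) (hQ : ‖Q‖ < 1) {n : ℕ} {a x : Fin n → ℂ}
    (hx : ∀ r, x r ≠ 0) (hinj : Function.Injective x)
    (hxx : ∀ r s, r ≠ s → ∀ i : ℕ, Q ^ i * (x r / x s) ≠ 1) (N : ℕ) :
    (1 - Q ^ (N + 1)) * milneLillyLevel Q a x (N + 1)
      = ∑ r, Q ^ N * shiftWeight a x r * milneLillyLevel Q (Function.update a r (Q * a r))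
          (Function.update x r (Q * x r)) N := by
  have h1 : ∀ k ∈ piAntidiag (univ : Finset (Fin n)) (N + 1),
      (1 - Q ^ (N + 1)) * milneLillyCoeff Q a x k
        = ∑ r, milneLillyCoeff Q a x k * ((1 - Q ^ k r)
          * ∏ s ∈ univ.erase r, (x r - x s * Q ^ k s) / (x r - x s)) := fun k hk => by
    rw [← mul_sum, sum_one_sub_mul_prod hx hinj fun r => Q ^ k r, prod_pow_eq_pow_sum,
      (mem_piAntidiag.1 hk).1, mul_comm]
  rw [milneLillyLevel, mul_sum, sum_congr rfl h1, sum_comm]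
  refine sum_congr rfl fun r _ => ?_
  rw [milneLillyLevel, mul_sum]
  symm
  refine sum_of_injOn (fun l => Function.update l r (l r + 1)) ?_ ?_ ?_ ?_
  · intro l _ l' _ h
    funext s
    have := congrFun h s
    rcases eq_or_ne s r with rfl | hs
    · simpa using this
    · simpa [hs] using this
  · intro l hl
    simp only [mem_coe, mem_piAntidiag, mem_univ, implies_true, and_true] at hl
    simp only [mem_coe, mem_piAntidiag, mem_univ, implies_true, and_true]
    rw [sum_update_of_mem (mem_univ r), ← hl, ← add_sum_erase univ l (mem_univ r),
      sdiff_singleton_eq_erase]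
    ring
  -- Outside the image of the shift `k r = 0`, and the factor `1 - Q ^ k r` vanishes.
  · intro k hk hk'
    have : k r = 0 := by
      by_contra h0
      refine hk' ⟨Function.update k r (k r - 1), ?_, ?_⟩
      · simp only [mem_piAntidiag, mem_univ, implies_true, and_true] at hk
        simp only [mem_coe, mem_piAntidiag, mem_univ, implies_true, and_true]
        rw [sum_update_of_mem (mem_univ r), sdiff_singleton_eq_erase]
        rw [← add_sum_erase univ k (mem_univ r)] at hk
        omega
      · simp [Nat.sub_add_cancel (Nat.pos_of_ne_zero h0)]
    simp [this]
  · intro l hl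
    rw [← (mem_piAntidiag.1 hl).1, milneLillyCoeff_shift hQ0 hQ hx hxx]
    simp only [Function.update_self]
    congr 2
    exact prod_congr rfl fun s hs => by rw [Function.update_of_ne (ne_of_mem_erase hs)]

/-! ### The generating function of the levels -/

open PowerSeries in
/-- The `q`-binomial series in one variable, scaled by `1 / ξ`, as a formal power series. -/
noncomputable def qBinomSeries (Q α ξ : ℂ) : PowerSeries ℂ :=
  PowerSeries.mk fun k => qBinomCoeff α Q k * (ξ ^ k)⁻¹

open PowerSeries in
theorem one_sub_mul_qBinomSeries {Q : ℂ} (hQ : ‖Q‖ < 1) (α ξ : ℂ) :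
    (1 - C ξ⁻¹ * X) * qBinomSeries Q α ξ
      = (1 - C (α * ξ⁻¹) * X) * rescale Q (qBinomSeries Q α ξ) := by
  ext k
  rw [sub_mul, sub_mul, one_mul, one_mul, mul_assoc, mul_assoc, map_sub, map_sub, coeff_C_mul,
    coeff_C_mul]
  rcases k with _ | k
  · simp [qBinomSeries]
  · rw [coeff_succ_X_mul, coeff_succ_X_mul]
    simp only [coeff_rescale, qBinomSeries, coeff_mk, ← inv_pow]
    linear_combination (ξ⁻¹) ^ (k + 1) * qBinomCoeff_succ_mul hQ α k

open PowerSeries in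
-- Heuristically the series is `(αX/ξ; Q)_∞ / (X/ξ; Q)_∞`. Under the shift and `X ↦ QX` the quotient
-- `α/ξ` is kept, and only the denominator factor `1 - X/ξ` is left over.
theorem one_sub_mul_qBinomSeries_shift {Q : ℂ} (hQ0 : Q ≠ 0) (hQ : ‖Q‖ < 1) (α : ℂ) {ξ : ℂ} :
    (1 - C ξ⁻¹ * X) * rescale Q (qBinomSeries Q (Q * α) (Q * ξ))
      = rescale Q (qBinomSeries Q α ξ) := by
  ext k
  rw [sub_mul, one_mul, mul_assoc, map_sub, coeff_C_mul]
  have e : ∀ k : ℕ, Q ^ k * (qBinomCoeff (Q * α) Q k * ((Q * ξ) ^ k)⁻¹)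
      = qBinomCoeff (Q * α) Q k * ξ⁻¹ ^ k := fun k => by
    have := pow_ne_zero k hQ0
    rw [mul_pow, mul_inv, inv_pow]
    field_simp
  rcases k with _ | k
  · simp [qBinomSeries]
  · rw [coeff_succ_X_mul]
    simp only [coeff_rescale, qBinomSeries, coeff_mk]
    rw [e, e]
    have h1 := qBinomCoeff_succ_mul hQ (Q * α) k
    have h2 := qBinomCoeff_succ_mul' hQ α k
    have h0 : 1 - Q ^ (k + 1) ≠ 0 := by
      rw [pow_succ']; exact sub_ne_zero.2 (mul_pow_ne_one hQ hQ k).symm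
    apply mul_left_cancel₀ h0
    rw [← inv_pow]
    linear_combination ξ⁻¹ ^ (k + 1) * h1 - Q ^ (k + 1) * ξ⁻¹ ^ (k + 1) * h2

open PowerSeries in
-- After multiplication by `∏ (1 - X / x r)` every term is a polynomial times the rescaled product,
-- and the claim becomes `prod_one_sub_C_mul_X`. Its coefficient of `X^(N+1)` is the recurrence of
-- `milneLillyLevel_succ`.
theorem prod_qBinomSeries_sub_rescale {Q : ℂ} (hQ0 : Q ≠ 0) (hQ : ‖Q‖ < 1) {n : ℕ}
    {a x : Fin n → ℂ} (hx : ∀ r, x r ≠ 0) (hinj : Function.Injective x) :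
    ∏ r, qBinomSeries Q (a r) (x r) - rescale Q (∏ r, qBinomSeries Q (a r) (x r))
      = X * ∑ r, C (shiftWeight a x r) * rescale Q (∏ s, qBinomSeries Q
          (Function.update a r (Q * a r) s) (Function.update x r (Q * x r) s)) := by
  have hP : ∏ r, (1 - C (x r)⁻¹ * X : PowerSeries ℂ) ≠ 0 := prod_ne_zero_iff.2 fun r _ h => by
    simpa using congrArg constantCoeff h
  have hpf := congrArg (fun p : Polynomial ℂ => (p : PowerSeries ℂ))
    (prod_one_sub_C_mul_X a hx hinj)
  simp only [← Polynomial.coeToPowerSeries.ringHom_apply, map_prod, map_add, map_mul, map_sum,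
    map_sub, map_one] at hpf
  simp only [Polynomial.coeToPowerSeries.ringHom_apply, Polynomial.coe_X, Polynomial.coe_C] at hpf
  have h1 : (∏ r, (1 - C (x r)⁻¹ * X)) * ∏ r, qBinomSeries Q (a r) (x r)
      = (∏ r, (1 - C (a r * (x r)⁻¹) * X)) * rescale Q (∏ r, qBinomSeries Q (a r) (x r)) := by
    rw [map_prod, ← prod_mul_distrib, ← prod_mul_distrib]
    exact prod_congr rfl fun r _ => one_sub_mul_qBinomSeries hQ _ _
  have h2 : ∀ r, (∏ s, (1 - C (x s)⁻¹ * X)) * rescale Q (∏ s, qBinomSeries Q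
          (Function.update a r (Q * a r) s) (Function.update x r (Q * x r) s))
      = (∏ s ∈ univ.erase r, (1 - C (x s)⁻¹ * X))
        * rescale Q (∏ r, qBinomSeries Q (a r) (x r)) := fun r => by
    have h3 : ∏ s ∈ univ.erase r, rescale Q (qBinomSeries Q
          (Function.update a r (Q * a r) s) (Function.update x r (Q * x r) s))
        = ∏ s ∈ univ.erase r, rescale Q (qBinomSeries Q (a s) (x s)) :=
      prod_congr rfl fun s hs => by
        rw [Function.update_of_ne (ne_of_mem_erase hs), Function.update_of_ne (ne_of_mem_erase hs)]
    rw [map_prod, map_prod, ← mul_prod_erase univ _ (mem_univ r),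
      ← mul_prod_erase univ (fun s => rescale Q (qBinomSeries Q
          (Function.update a r (Q * a r) s) _)) (mem_univ r),
      ← mul_prod_erase univ (fun r => rescale Q (qBinomSeries Q (a r) (x r))) (mem_univ r),
      ← one_sub_mul_qBinomSeries_shift hQ0 hQ (a r), h3]
    simp only [Function.update_self]
    ring
  apply mul_left_cancel₀ hP
  simp only [map_mul C] at h1
  rw [mul_sub, h1, hpf, add_mul, add_sub_cancel_left, mul_left_comm _ X, mul_assoc]
  congr 1
  rw [mul_sum, sum_mul]
  refine sum_congr rfl fun r _ => ?_
  rw [mul_left_comm, h2, mul_assoc]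

/-- Both sides obey the same recurrence and start at `1`. The induction runs over all `a` and `x` at
once because the recurrence shifts them. -/
theorem milneLillyLevel_eq_coeff {Q : ℂ} (hQ0 : Q ≠ 0) (hQ : ‖Q‖ < 1) {n : ℕ} (N : ℕ) :
    ∀ {a x : Fin n → ℂ}, (∀ r, x r ≠ 0) →
      (∀ r s, r ≠ s → ∀ i : ℕ, Q ^ i * (x r / x s) ≠ 1) →
      milneLillyLevel Q a x N = PowerSeries.coeff N (∏ r, qBinomSeries Q (a r) (x r)) := by
  induction N with
  | zero =>
    intro a x hx hxx
    have hne : ∀ p, ∀ s ∈ Ioi p, x s - x p ≠ 0 := fun p s hs h =>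
      hxx s p (mem_Ioi.1 hs).ne' 0 (by rw [pow_zero, one_mul, sub_eq_zero.1 h, div_self (hx p)])
    simpa [milneLillyLevel, milneLillyCoeff, pairFactor, qBinomSeries, map_prod] using
      prod_ne_zero_iff.2 fun p _ => prod_ne_zero_iff.2 (hne p)
  | succ N ih =>
    intro a x hx hxx
    have hinj : Function.Injective x := fun r s h => by
      by_contra hrs
      exact hxx r s hrs 0 (by rw [pow_zero, one_mul, h, div_self (hx s)])
    have h0 : 1 - Q ^ (N + 1) ≠ 0 := by
      rw [pow_succ']; exact sub_ne_zero.2 (mul_pow_ne_one hQ hQ N).symm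
    apply mul_left_cancel₀ h0
    rw [milneLillyLevel_succ hQ0 hQ hx hinj hxx]
    have h := congrArg (PowerSeries.coeff (N + 1)) (prod_qBinomSeries_sub_rescale hQ0 hQ
      (a := a) hx hinj)
    rw [map_sub, PowerSeries.coeff_rescale, PowerSeries.coeff_succ_X_mul, map_sum] at h
    rw [sub_mul, one_mul, h]
    refine sum_congr rfl fun r _ => ?_
    rw [PowerSeries.coeff_C_mul, PowerSeries.coeff_rescale, ih]
    · ring
    · intro s
      rcases eq_or_ne s r with rfl | hs
      · simpa using ⟨hQ0, hx s⟩
      · simpa [hs] using hx s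
    · intro p s hps i
      rcases eq_or_ne p r with rfl | hp
      · rw [Function.update_self, Function.update_of_ne hps.symm]
        convert hxx p s hps (i + 1) using 1
        ring
      · rw [Function.update_of_ne hp]
        rcases eq_or_ne s r with rfl | hs
        · rw [Function.update_self]
          -- For exponent `0` the requirement `x p ≠ Q * x s` is the hypothesis for the reversed
          -- pair with exponent `1`.
          rcases i with _ | i
          · intro h
            refine hxx s p hps.symm 1 ?_
            rw [pow_zero, one_mul, div_eq_one_iff_eq (mul_ne_zero hQ0 (hx s))] at h
            rw [pow_one, mul_div_assoc', ← h, div_self (hx p)]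
          · convert hxx p s hps i using 1
            have := hx s
            rw [pow_succ]
            field_simp
        · rw [Function.update_of_ne hs]
          exact hxx p s hps i

theorem coeff_prod_qBinomSeries (Q : ℂ) {n : ℕ} (a x : Fin n → ℂ) (N : ℕ) :
    PowerSeries.coeff N (∏ r, qBinomSeries Q (a r) (x r))
      = ∑ k ∈ piAntidiag univ N, ∏ r, qBinomCoeff (a r) Q (k r) * (x r ^ k r)⁻¹ := by
  rw [PowerSeries.coeff_prod]
  refine sum_nbij' (fun l => ⇑l) (fun k => Finsupp.equivFunOnFinite.symm k) ?_ ?_ ?_ ?_ ?_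
  all_goals simp [qBinomSeries]

/-! ### The Milne–Lilly `q`-binomial theorem -/

theorem exists_norm_pairFactor_le {Q : ℂ} (hQ : ‖Q‖ < 1) {n : ℕ} (a : Fin n → ℂ) {x : Fin n → ℂ}
    (hxx : ∀ r s, r ≠ s → ∀ i : ℕ, Q ^ i * (x r / x s) ≠ 1) {p s : Fin n} (hps : p ≠ s) :
    ∃ C : ℝ, 0 ≤ C ∧ ∀ k, ‖pairFactor Q a x k p s‖ ≤ C := by
  obtain ⟨C, hC0, hC⟩ := exists_norm_qFac_div_le (a s * (x p / x s)) (B := Q * (x p / x s)) hQ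
    fun i => by convert hxx p s hps (i + 1) using 1; ring
  obtain ⟨D, hD0, hD⟩ := exists_norm_qFac_div_le (a p * (x s / x p)) (B := Q * (x s / x p)) hQ
    fun i => by convert hxx s p hps.symm (i + 1) using 1; ring
  refine ⟨(‖x s‖ + ‖x p‖) / ‖x s - x p‖ * 1 * (C * D), by positivity, fun k => ?_⟩
  have hpow : ∀ i : ℕ, ‖Q ^ i‖ ≤ 1 := fun i => by
    rw [norm_pow]; exact pow_le_one₀ (norm_nonneg _) hQ.le
  have hx : ∀ i : ℕ, ∀ y : ℂ, ‖y * Q ^ i‖ ≤ ‖y‖ := fun i y => by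
    rw [norm_mul]; exact mul_le_of_le_one_right (norm_nonneg _) (hpow i)
  rw [pairFactor, norm_mul, norm_mul, norm_mul, norm_div]
  gcongr
  · exact (norm_sub_le _ _).trans (add_le_add (hx _ _) (hx _ _))
  · exact hpow _
  · exact hC _
  · exact hD _

/-- The pair factors are bounded uniformly in `k`, so the product of `n` one-variable series
dominates. -/
theorem summable_milneLillyTerm {Q : ℂ} (hQ0 : Q ≠ 0) (hQ : ‖Q‖ < 1) {n : ℕ} (a : Fin n → ℂ)
    {x : Fin n → ℂ} (hx : ∀ r, x r ≠ 0) (hxx : ∀ r s, r ≠ s → ∀ i : ℕ, Q ^ i * (x r / x s) ≠ 1)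
    {z : ℂ} (hz : ∀ r, ‖z / x r‖ < 1) : Summable (milneLillyTerm Q a x z) := by
  have hC : ∀ p s : Fin n, ∃ C : ℝ, s ∈ Ioi p → ∀ k, ‖pairFactor Q a x k p s‖ ≤ C :=
    fun p s => by
      by_cases h : p = s
      · exact ⟨0, fun hs => absurd (mem_Ioi.1 hs) (by simp [h])⟩
      · obtain ⟨C, -, hC⟩ := exists_norm_pairFactor_le hQ a hxx h
        exact ⟨C, fun _ => hC⟩
  choose C hC using hC
  have hs := (hasSum_prod_pi fun r => summable_norm_qBinom hQ (hz r) (a r)).summable.norm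
  refine Summable.of_norm_bounded (hs.mul_right (∏ p, ∏ s ∈ Ioi p, C p s)) fun k => ?_
  have e : milneLillyTerm Q a x z k = (∏ r, qBinomCoeff (a r) Q (k r) * (z / x r) ^ k r)
      * ∏ p, ∏ s ∈ Ioi p, pairFactor Q a x k p s := by
    rw [milneLillyTerm_eq hQ0 a hx, milneLillyCoeff, size, ← prod_pow_eq_pow_sum,
      mul_right_comm, ← prod_mul_distrib]
    congr 1
    exact prod_congr rfl fun r _ => by rw [div_pow]; ring
  rw [e, norm_mul]
  gcongr
  simp only [norm_prod]
  exact prod_le_prod (fun _ _ => prod_nonneg fun _ _ => norm_nonneg _) fun p _ =>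
    prod_le_prod (fun _ _ => norm_nonneg _) fun s hs => hC p s hs k

/-- The product of the one-variable series has the right value, and its part with `|k| = N` has the
same sum as that of the Milne–Lilly series, although individual terms differ. -/
theorem hasSum_milneLillyTerm {Q : ℂ} (hQ0 : Q ≠ 0) (hQ : ‖Q‖ < 1) {n : ℕ} (a : Fin n → ℂ)
    {x : Fin n → ℂ} (hx : ∀ r, x r ≠ 0) (hxx : ∀ r s, r ≠ s → ∀ i : ℕ, Q ^ i * (x r / x s) ≠ 1)
    {z : ℂ} (hz : ∀ r, ‖z / x r‖ < 1) :
    HasSum (milneLillyTerm Q a x z) (∏ r, qInf (a r * z / x r) Q / qInf (z / x r) Q) := by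
  have h1 := (summable_milneLillyTerm hQ0 hQ a hx hxx hz).hasSum
  have h2 := hasSum_prod_pi fun r => summable_norm_qBinom hQ (hz r) (a r)
  simp only [(hasSum_qBinom hQ (hz _) (a _)).tsum_eq] at h2
  simp only [mul_div_assoc]
  convert h1 using 1
  refine hasSum_unique_of_piAntidiag h2 h1 fun N => ?_
  have h3 := (coeff_prod_qBinomSeries Q a x N).symm.trans
    (milneLillyLevel_eq_coeff hQ0 hQ N hx hxx).symm
  calc _ = z ^ N * ∑ k ∈ piAntidiag univ N, ∏ r, qBinomCoeff (a r) Q (k r) * (x r ^ k r)⁻¹ := by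
        rw [mul_sum]
        refine sum_congr rfl fun k hk => ?_
        rw [← (mem_piAntidiag.1 hk).1, ← prod_pow_eq_pow_sum, ← prod_mul_distrib]
        exact prod_congr rfl fun r _ => by rw [div_pow]; ring
    _ = _ := by
        rw [h3, milneLillyLevel, mul_sum]
        refine sum_congr rfl fun k hk => ?_
        rw [milneLillyTerm_eq hQ0 a hx, size, (mem_piAntidiag.1 hk).1, mul_comm]

/-! ### The Gustafson–Krattenthaler `q`-binomial theorem -/

theorem gustafsonKrattenthalerTerm_eq {Q : ℂ} (hQ0 : Q ≠ 0) {m : ℕ} (b : ℂ) {y : Fin m → ℂ}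
    (hy : ∀ r, y r ≠ 0) (w : ℂ) (j : Fin m → ℕ) :
    gustafsonKrattenthalerTerm Q b y w j
      = (∑ σ : Equiv.Perm (Fin m), ((Equiv.Perm.sign σ : ℤ) : ℂ) *
          ∏ r, y r ^ (σ.symm r : ℕ) * (qBinomCoeff b Q (j r) * (w * Q ^ (σ.symm r : ℕ)) ^ j r))
        / (Matrix.vandermonde y).det := by
  have h1 : gustafsonKrattenthalerTerm Q b y w j
      = (Matrix.vandermonde fun r => y r * Q ^ j r).det / (Matrix.vandermonde y).det
        * ∏ r, qBinomCoeff b Q (j r) * w ^ j r := by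
    rw [Matrix.det_vandermonde, Matrix.det_vandermonde]
    simp only [← prod_div_distrib]
    rw [← vandermonde_mul_pow hQ0 hy, gustafsonKrattenthalerTerm, size, ← prod_pow_eq_pow_sum,
      prod_mul_distrib]
    simp only [qBinomCoeff]
    ring
  rw [h1, div_mul_eq_mul_div, Matrix.det_apply', sum_mul]
  congr 1
  refine sum_congr rfl fun σ _ => ?_
  rw [mul_assoc, ← Equiv.prod_comp σ fun r => qBinomCoeff b Q (j r) * w ^ j r,
    ← Equiv.prod_comp σ fun r => y r ^ (σ.symm r : ℕ) * _, ← prod_mul_distrib]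
  congr 1
  refine prod_congr rfl fun r _ => ?_
  rw [Matrix.vandermonde_apply, Equiv.symm_apply_apply]
  ring

/-- For each permutation the series factors into one-variable series at `w Q^i`, with `i` running
once through all exponents. The product of their values is therefore independent of the permutation,
and the signed monomials in `y` reassemble the Vandermonde determinant. -/
theorem hasSum_gustafsonKrattenthalerTerm {Q : ℂ} (hQ0 : Q ≠ 0) (hQ : ‖Q‖ < 1) {m : ℕ} (b : ℂ)
    {y : Fin m → ℂ} (hy : ∀ r, y r ≠ 0) (hyy : ∀ r s, r ≠ s → y r / y s ≠ 1) {w : ℂ}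
    (hw : ‖w‖ < 1) :
    HasSum (gustafsonKrattenthalerTerm Q b y w)
      (∏ r : Fin m, qInf (b * w * Q ^ (r : ℕ)) Q / qInf (w * Q ^ (r : ℕ)) Q) := by
  have hdet : (Matrix.vandermonde y).det ≠ 0 :=
    Matrix.det_vandermonde_ne_zero_iff.2 fun r s h => by
      by_contra hrs
      exact hyy r s hrs (by rw [h, div_self (hy s)])
  have hw' : ∀ i : ℕ, ‖w * Q ^ i‖ < 1 := norm_mul_pow_lt_one hw hQ
  have hσ : ∀ σ : Equiv.Perm (Fin m), HasSum (fun j : Fin m → ℕ =>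
      ((Equiv.Perm.sign σ : ℤ) : ℂ) * ∏ r, y r ^ (σ.symm r : ℕ)
        * (qBinomCoeff b Q (j r) * (w * Q ^ (σ.symm r : ℕ)) ^ j r))
      (((Equiv.Perm.sign σ : ℤ) : ℂ) * ∏ i, y (σ i) ^ (i : ℕ)
        * (qInf (b * w * Q ^ (i : ℕ)) Q / qInf (w * Q ^ (i : ℕ)) Q)) := fun σ => by
    have h := hasSum_prod_pi (f := fun r k => y r ^ (σ.symm r : ℕ)
      * (qBinomCoeff b Q k * (w * Q ^ (σ.symm r : ℕ)) ^ k)) fun r => by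
        simp only [norm_mul (y r ^ _)]
        exact (summable_norm_qBinom hQ (hw' _) b).mul_left _
    simp only [tsum_mul_left, (hasSum_qBinom hQ (hw' _) b).tsum_eq] at h
    rw [← Equiv.prod_comp σ] at h
    simp only [Equiv.symm_apply_apply, ← mul_assoc b] at h
    exact h.mul_left _
  have h := (hasSum_sum fun σ (_ : σ ∈ univ) => hσ σ).div_const (Matrix.vandermonde y).det
  have e : ∏ r : Fin m, qInf (b * w * Q ^ (r : ℕ)) Q / qInf (w * Q ^ (r : ℕ)) Q
      = (∑ σ : Equiv.Perm (Fin m), ((Equiv.Perm.sign σ : ℤ) : ℂ) * ∏ i, y (σ i) ^ (i : ℕ)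
        * (qInf (b * w * Q ^ (i : ℕ)) Q / qInf (w * Q ^ (i : ℕ)) Q))
        / (Matrix.vandermonde y).det := by
    rw [eq_div_iff hdet, Matrix.det_apply', mul_sum]
    refine sum_congr rfl fun σ _ => ?_
    rw [prod_mul_distrib]
    simp only [Matrix.vandermonde_apply]
    ring
  rw [e]
  exact h.congr_fun fun j => gustafsonKrattenthalerTerm_eq hQ0 b hy w j

/-! ### The bibasic Heine transformation -/

theorem qpow_ne_zero (lq α : ℂ) : qpow lq α ≠ 0 := Complex.exp_ne_zero _

theorem qpow_mul_natCast (lq α : ℂ) (N : ℕ) : qpow lq (α * N) = qpow lq α ^ N := by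
  rw [qpow, qpow, ← Complex.exp_nat_mul]
  congr 1
  ring

theorem qFacC_mul_natCast (lq A s α : ℂ) (N : ℕ) :
    qFacC lq A s (α * N) = qInf A (qpow lq s) / qInf (A * qpow lq (s * α) ^ N) (qpow lq s) := by
  rw [qFacC, ← qpow_mul_natCast, mul_assoc]

theorem milneLillyTerm_mul (Q : ℂ) {n : ℕ} (a x : Fin n → ℂ) (z c : ℂ) (k : Fin n → ℕ) :
    milneLillyTerm Q a x (z * c) k = milneLillyTerm Q a x z k * c ^ size k := by
  rw [milneLillyTerm, milneLillyTerm, mul_pow]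
  ring

theorem gustafsonKrattenthalerTerm_mul (Q b : ℂ) {m : ℕ} (y : Fin m → ℂ) (w c : ℂ)
    (j : Fin m → ℕ) :
    gustafsonKrattenthalerTerm Q b y (w * c) j
      = gustafsonKrattenthalerTerm Q b y w j * c ^ size j := by
  rw [gustafsonKrattenthalerTerm, gustafsonKrattenthalerTerm, mul_pow]
  ring

theorem leftTerm_eq (lq h t : ℂ) {n : ℕ} (m : ℕ) (a x : Fin n → ℂ) (b z w : ℂ)
    (k : Fin n → ℕ) :
    leftTerm lq h t m a x b z w k = milneLillyTerm (qpow lq h) a x z k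
      * ∏ r : Fin m, qFacC lq (w * qpow lq t ^ (r : ℕ)) t (h * size k)
        / qFacC lq (b * w * qpow lq t ^ (r : ℕ)) t (h * size k) := by
  simp only [leftTerm, milneLillyTerm, qpow_mul_natCast]
  ring

theorem rightTerm_eq (lq h t : ℂ) {n m : ℕ} (a x : Fin n → ℂ) (y : Fin m → ℂ) (b z w : ℂ)
    (j : Fin m → ℕ) :
    rightTerm lq h t a x y b z w j = gustafsonKrattenthalerTerm (qpow lq t) b y w j
      * ∏ r, qFacC lq (z / x r) h (t * size j) / qFacC lq (a r * z / x r) h (t * size j) := by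
  simp only [rightTerm, gustafsonKrattenthalerTerm, qpow_mul_natCast]
  ring

theorem summable_mul_mul_pow {ι κ : Type*} {f : ι → ℂ} {g : κ → ℂ} (hf : Summable f)
    (hg : Summable g) {c : ℂ} (hc : ‖c‖ ≤ 1) (e : ι × κ → ℕ) :
    Summable fun p : ι × κ => f p.1 * g p.2 * c ^ e p := by
  refine Summable.of_norm_bounded (summable_mul_of_summable_norm hf.norm hg.norm).norm fun p => ?_
  rw [norm_mul _ (c ^ _), norm_pow]
  exact mul_le_of_le_one_right (norm_nonneg _) (pow_le_one₀ (norm_nonneg _) hc)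

end BibasicHeine

open BibasicHeine

theorem mainTheorem4 (n m : ℕ) (q lq : ℂ) (hq : Complex.exp lq = q) (h t : ℂ)
    (a x : Fin n → ℂ) (y : Fin m → ℂ) (b z w : ℂ)
    -- the usual convergence conditions `0 < |q^h|, |q^t|, |q^(ht)| < 1`
    (hh : ‖BibasicHeine.qpow lq h‖ < 1) (ht : ‖BibasicHeine.qpow lq t‖ < 1)
    (hht : ‖BibasicHeine.qpow lq (h * t)‖ < 1)
    (hw : ‖w‖ < 1) (hz : ∀ r, ‖z / x r‖ < 1)
    -- no denominator in the identity vanishes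
    (hx : ∀ r, x r ≠ 0) (hy : ∀ r, y r ≠ 0)
    (hxx : ∀ r s, r ≠ s → ∀ i : ℕ, BibasicHeine.qpow lq h ^ i * (x r / x s) ≠ 1)
    (hyy : ∀ r s, r ≠ s → y r / y s ≠ 1)
    (hb : ∀ i : ℕ, b * w * BibasicHeine.qpow lq t ^ i ≠ 1)
    (ha : ∀ r, ∀ i : ℕ, a r * z / x r * BibasicHeine.qpow lq h ^ i ≠ 1) :
    -- absolute convergence of both series, and the transformation formula
    (Summable (BibasicHeine.leftTerm lq h t m a x b z w) ∧
      Summable (BibasicHeine.rightTerm lq h t a x y b z w) ∧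
      ∑' k : Fin n → ℕ, BibasicHeine.leftTerm lq h t m a x b z w k =
        (∏ r : Fin m,
            BibasicHeine.qInf (w * BibasicHeine.qpow lq (t * (r : ℕ))) (BibasicHeine.qpow lq t)
            / BibasicHeine.qInf (b * w * BibasicHeine.qpow lq (t * (r : ℕ)))
                (BibasicHeine.qpow lq t))
        * (∏ r : Fin n, BibasicHeine.qInf (a r * z / x r) (BibasicHeine.qpow lq h)
            / BibasicHeine.qInf (z / x r) (BibasicHeine.qpow lq h))
        * ∑' j : Fin m → ℕ, BibasicHeine.rightTerm lq h t a x y b z w j) ∧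
    -- for `b = 1` it becomes the Milne–Lilly `q`-binomial theorem with base `q^h`
    (b = 1 →
      BibasicHeine.leftTerm lq h t m a x b z w =
          BibasicHeine.milneLillyTerm (BibasicHeine.qpow lq h) a x z ∧
      HasSum (BibasicHeine.milneLillyTerm (BibasicHeine.qpow lq h) a x z)
        (∏ r : Fin n, BibasicHeine.qInf (a r * z / x r) (BibasicHeine.qpow lq h)
            / BibasicHeine.qInf (z / x r) (BibasicHeine.qpow lq h))) ∧
    -- for `a_1 = ⋯ = a_n = 1` it becomes the Gustafson–Krattenthaler one with base `q^t`
    ((∀ r, a r = 1) →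
      BibasicHeine.rightTerm lq h t a x y b z w =
          BibasicHeine.gustafsonKrattenthalerTerm (BibasicHeine.qpow lq t) b y w ∧
      HasSum (BibasicHeine.gustafsonKrattenthalerTerm (BibasicHeine.qpow lq t) b y w)
        (∏ r : Fin m, BibasicHeine.qInf (b * w * BibasicHeine.qpow lq t ^ (r : ℕ))
              (BibasicHeine.qpow lq t)
            / BibasicHeine.qInf (w * BibasicHeine.qpow lq t ^ (r : ℕ))
              (BibasicHeine.qpow lq t))) := by
  set Q := qpow lq h with hQdef
  set P := qpow lq t with hPdef
  set c := qpow lq (h * t) with hcdef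
  have hQ0 : Q ≠ 0 := qpow_ne_zero _ _
  have hP0 : P ≠ 0 := qpow_ne_zero _ _
  have hth : qpow lq (t * h) = c := by rw [mul_comm]
  have hpz : ∀ (s : Fin n) (J : ℕ), ‖z / x s * c ^ J‖ < 1 := fun s J =>
    norm_mul_pow_lt_one (hz s) hht J
  have hz0 : ∀ (s : Fin n) (J : ℕ), qInf (z / x s * c ^ J) Q ≠ 0 := fun s J =>
    qInf_ne_zero hh (mul_pow_ne_one (hpz s J) hh)
  have haz0 : ∀ s, qInf (a s * z / x s) Q ≠ 0 := fun s => qInf_ne_zero hh (ha s)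
  have hw0 : ∀ K r : ℕ, qInf (w * P ^ r * c ^ K) P ≠ 0 := fun K r =>
    qInf_ne_zero ht (mul_pow_ne_one (norm_mul_pow_lt_one (norm_mul_pow_lt_one hw ht r) hht K) ht)
  have hML : ∀ J : ℕ, HasSum (milneLillyTerm Q a x (z * c ^ J))
      (∏ r, qInf (a r * z / x r * c ^ J) Q / qInf (z / x r * c ^ J) Q) := fun J => by
    convert hasSum_milneLillyTerm hQ0 hh a hx hxx (z := z * c ^ J)
      (fun r => by rw [mul_div_right_comm]; exact hpz r J) using 4 with r
    · ring
    · ring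
  have hGK : ∀ K : ℕ, HasSum (gustafsonKrattenthalerTerm P b y (w * c ^ K))
      (∏ r : Fin m, qInf (b * w * P ^ (r : ℕ) * c ^ K) P / qInf (w * P ^ (r : ℕ) * c ^ K) P) :=
    fun K => by
      convert hasSum_gustafsonKrattenthalerTerm hP0 ht b hy hyy (w := w * c ^ K)
        (norm_mul_pow_lt_one hw hht K) using 4 with r
      · ring
      · ring
  have hML0 := hML 0
  have hGK0 := hGK 0
  simp only [pow_zero, mul_one] at hML0 hGK0
  set A := ∏ r : Fin m, qInf (w * P ^ (r : ℕ)) P / qInf (b * w * P ^ (r : ℕ)) P with hA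
  set B := ∏ r : Fin n, qInf (a r * z / x r) Q / qInf (z / x r) Q with hB
  have hz00 : ∀ s, qInf (z / x s) Q ≠ 0 := fun s => by simpa using hz0 s 0
  have hB0 : B ≠ 0 := prod_ne_zero_iff.2 fun r _ => div_ne_zero (haz0 r) (hz00 r)
  -- The double series whose two iterated sums are, up to the prefactors `A` and `B`, the two sides.
  set F : (Fin n → ℕ) × (Fin m → ℕ) → ℂ := fun p =>
    milneLillyTerm Q a x z p.1 * gustafsonKrattenthalerTerm P b y w p.2 * c ^ (size p.1 * size p.2)
    with hF
  have hFs : Summable F := summable_mul_mul_pow hML0.summable hGK0.summable hht.le _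
  have hL : ∀ k, HasSum (fun j => A * F (k, j)) (leftTerm lq h t m a x b z w k) := fun k => by
    have h1 := (hGK (size k)).mul_left (A * milneLillyTerm Q a x z k)
    have e : leftTerm lq h t m a x b z w k = A * milneLillyTerm Q a x z k * ∏ r : Fin m,
        qInf (b * w * P ^ (r : ℕ) * c ^ size k) P / qInf (w * P ^ (r : ℕ) * c ^ size k) P := by
      rw [leftTerm_eq, mul_comm A, mul_assoc, hA, ← prod_mul_distrib]
      congr 1
      refine prod_congr rfl fun r _ => ?_
      -- If `(b w P^r c^|k|; P)_∞ = 0`, division by zero makes the quotient in `leftTerm` zero,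
      -- which agrees with this vanishing numerator; no case distinction is needed.
      rw [qFacC_mul_natCast, qFacC_mul_natCast, hth, ← hPdef, div_div_div_eq, div_mul_div_comm,
        mul_comm (qInf (b * w * P ^ (r : ℕ)) P)]
    rw [e]
    refine h1.congr_fun fun j => ?_
    rw [gustafsonKrattenthalerTerm_mul, hF, ← pow_mul]
    ring
  have hR : ∀ j, HasSum (fun k => F (k, j)) (B * rightTerm lq h t a x y b z w j) := fun j => by
    have h1 := (hML (size j)).mul_left (gustafsonKrattenthalerTerm P b y w j)
    have e : B * rightTerm lq h t a x y b z w j = gustafsonKrattenthalerTerm P b y w j * ∏ r,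
        qInf (a r * z / x r * c ^ size j) Q / qInf (z / x r * c ^ size j) Q := by
      rw [rightTerm_eq, mul_left_comm, hB, ← prod_mul_distrib]
      congr 1
      refine prod_congr rfl fun r _ => ?_
      rw [qFacC_mul_natCast, qFacC_mul_natCast, ← hcdef, ← hQdef, div_div_div_eq,
        div_mul_div_comm, ← mul_assoc, mul_comm (qInf (z / x r * _) Q), ← mul_assoc,
        mul_comm (qInf (z / x r) Q), mul_div_mul_left _ _ (mul_ne_zero (haz0 r) (hz00 r))]
    rw [e]
    refine h1.congr_fun fun k => ?_
    rw [milneLillyTerm_mul, hF, ← pow_mul]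
    ring
  have hsum := hFs.mul_left A
  have hSL := hsum.hasSum.prod_fiberwise hL
  have hSR := hFs.prod_symm.hasSum.prod_fiberwise hR
  -- Fubini gives summability only of `B` times the right-hand terms; `B ≠ 0` removes the factor.
  have hsR : Summable (rightTerm lq h t a x y b z w) :=
    (summable_mul_left_iff hB0).1 hSR.summable
  simp only [qpow_mul_natCast]
  refine ⟨⟨hSL.summable, hsR, ?_⟩, fun hb1 => ⟨?_, hML0⟩, fun ha1 => ⟨?_, hGK0⟩⟩
  · rw [hSL.tsum_eq, tsum_mul_left, mul_assoc, ← tsum_mul_left (a := B), hSR.tsum_eq]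
    congr 1
    exact ((Equiv.prodComm _ _).tsum_eq F).symm
  · funext k
    rw [leftTerm_eq]
    subst hb1
    rw [prod_eq_one fun r _ => ?_, mul_one]
    rw [one_mul, qFacC_mul_natCast, hth]
    have h0 := hw0 0 r
    rw [pow_zero, mul_one] at h0
    exact div_self (div_ne_zero h0 (hw0 _ _))
  · funext j
    rw [rightTerm_eq, prod_eq_one fun r _ => ?_, mul_one]
    rw [ha1 r, one_mul, qFacC_mul_natCast, ← hcdef]
    exact div_self (div_ne_zero (hz00 r) (hz0 _ _))
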